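/- A set-theoretic solution of the Yang–Baxter equation is a pair $(X,r)$ with $X$ a nonempty set and $r\colon X\times X\to X\times X$ a map such that $r_{12}r_{23}r_{12}=r_{23}r_{12}r_{23}$ on $X^3$, where $r_{12}=r\times\mathrm{id}_X$ and $r_{23}=\mathrm{id}_X\times r$. Write $r(x,y)=(f_x(y),g_y(x))$. The solution is involutive if $r^2=\mathrm{id}_{X\times X}$ and non-degenerate if all the maps $f_x,g_y\colon X\to X$ are bijective. The permutation group of an involutive non-degenerate solution is $\mathcal G(X,r)=\langle f_x\mid x\in X\rangle\le\mathrm{Sym}(X)$. A group $G$ is an IYB-group if $G\cong\mathcal G(X,r)$ for some involutive non-degenerate solution $(X,r)$. **Corollary.** Let $G$ be a finite soluble group such that, for every prime $p$, the Sylow $p$-subgroups of $G$ are nilpotent of class at most two. Suppose that $G$ is $2$-nilpotent, i.e. $G$ has a normal subgroup $N$ that is a complement to every Sylow $2$-subgroup $P$ of $G$ ($G=NP$ and $N\cap P=1$). Then $G$ is an IYB-group. -/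

import Mathlib

universe u

namespace YangBaxter

variable {X : Type u}

/-- The map `r × id` on `X³`. -/
def r12 (r : X × X → X × X) : X × X × X → X × X × X :=
  fun t => ((r (t.1, t.2.1)).1, (r (t.1, t.2.1)).2, t.2.2)

/-- The map `id × r` on `X³`. -/
def r23 (r : X × X → X × X) : X × X × X → X × X × X :=
  fun t => (t.1, r t.2)

variable (X) in
/-- An involutive, non-degenerate set-theoretic solution `(X, r)` of the Yang–Baxter equation.
Writing `r (x, y) = (f_x y, g_y x)`, non-degeneracy means that all `f_x` and `g_y` are
bijections of `X`. -/
structure Solution where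
  /-- the underlying set is non-empty -/
  nonempty : Nonempty X
  /-- the map `r : X × X → X × X` -/
  r : X × X → X × X
  /-- the (braided form of the) Yang–Baxter equation -/
  yangBaxter : r12 r ∘ r23 r ∘ r12 r = r23 r ∘ r12 r ∘ r23 r
  involutive : r ∘ r = id
  bijective_left : ∀ x : X, Function.Bijective (fun y : X => (r (x, y)).1)
  bijective_right : ∀ y : X, Function.Bijective (fun x : X => (r (x, y)).2)

/-- The permutation `f_x` of `X`, where `r (x, y) = (f_x y, g_y x)`. -/
noncomputable def Solution.f (S : Solution X) (x : X) : Equiv.Perm X :=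
  Equiv.ofBijective (fun y : X => (S.r (x, y)).1) (S.bijective_left x)

/-- The permutation group `𝒢(X, r) = ⟨f_x | x ∈ X⟩ ≤ Sym(X)`. -/
def Solution.permutationGroup (S : Solution X) : Subgroup (Equiv.Perm X) :=
  Subgroup.closure (Set.range S.f)

end YangBaxter

/-- `G` is an involutive Yang–Baxter group (IYB-group): it is isomorphic to the permutation group
of some involutive, non-degenerate set-theoretic solution of the Yang–Baxter equation. -/
def IsIYBGroup (G : Type u) [Group G] : Prop :=
  ∃ (X : Type u) (S : YangBaxter.Solution X), Nonempty (G ≃* S.permutationGroup)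

/-- A finite group is `p`-nilpotent if it has a normal `p`-complement, i.e. a normal subgroup
which is a complement to the Sylow `p`-subgroups. -/
def IsPNilpotentGroup (p : ℕ) (G : Type u) [Group G] : Prop :=
  ∃ N : Subgroup G, N.Normal ∧ ∀ P : Sylow p G, Subgroup.IsComplement' N (P : Subgroup G)

/-! A finite group with a bijective 1-cocycle into an abelian group, that is, with a regular affine
action, is an IYB-group. Such an action can be assembled prime by prime: suppose that for each `p`
the group acts transitively by affine maps on an abelian group whose order is the `p`-part of `|G|`.
In the product action the stabilizer of the origin has order prime to every prime divisor of `|G|`,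
so the action is regular.

Transitive affine actions pull back along surjections, so only a suitable quotient matters for each
`p`. A group of class at most two becomes abelian under `u + v = u v β(u,v)⁻¹`, where `β` is
bilinear with central values and `[u,v] = β(u,v)/β(v,u)`; left translations are then affine. For `p
= 2` this is applied to `G/N`, a copy of the Sylow 2-subgroup. For odd `p`, half the commutator
serves as `β` and is invariant under automorphisms, so the action extends to `P ⋊ H`. It remains to
show that the Sylow `p`-subgroup of `G/O_{p'}(G)` is normal.

That is a `p`-stability argument. If `O_{p'}(G) = 1`, then `R = O_p(G)` contains its centralizer and
`G/R` acts faithfully on the abelianization of `R`. Elements of `P` act quadratically there because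
`P` has class at most two, and `eq_one_of_quadratic` then forces `P ≤ R`. Its oddness hypothesis
holds because `P` lies in the normal 2-complement. -/

open scoped commutatorElement

/-! ### Solutions from bijective 1-cocycles -/

namespace YangBaxter

/-- A finite set `X` with an action of a group `G` and a map `d : X → G` satisfying the
compatibility `d x * d y = d (d x • y) * d ((d (d x • y))⁻¹ • x)` gives a solution of the
Yang–Baxter equation, provided that `x ↦ (d x)⁻¹ • x` is injective. -/
def Solution.ofAction {X : Type u} {G : Type*} [Group G] [MulAction G X] [Finite X] [Nonempty X]
    (d : X → G) (hd : ∀ x y, d x * d y = d (d x • y) * d ((d (d x • y))⁻¹ • x))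
    (hT : Function.Injective fun x => (d x)⁻¹ • x) : Solution X where
  nonempty := inferInstance
  r := fun t => (d t.1 • t.2, (d (d t.1 • t.2))⁻¹ • t.1)
  yangBaxter := by
    funext ⟨x, y, z⟩
    have h1 := hd x y
    have h2 := hd x (d y • z)
    have h3 := hd (d x • y) (d ((d (d x • y))⁻¹ • x) • z)
    have e1 : d (d x • y) • d ((d (d x • y))⁻¹ • x) • z = d x • d y • z := by
      rw [← mul_smul, ← h1, mul_smul]
    rw [e1] at h3
    have e2 : d ((d (d x • d y • z))⁻¹ • x) • (d (d y • z))⁻¹ • y =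
        (d (d x • d y • z))⁻¹ • d x • y := by
      rw [eq_inv_mul_of_mul_eq h2.symm]
      simp only [mul_smul, smul_inv_smul]
    simp only [Function.comp_apply, r12, r23, Prod.mk.injEq]
    refine ⟨e1, ?_, ?_⟩
    · rw [e1, e2]
    · rw [e2, ← mul_smul, ← mul_smul, ← mul_inv_rev, ← mul_inv_rev, h3]
  involutive := by
    funext ⟨x, y⟩
    simp
  bijective_left := fun x => MulAction.bijective (d x)
  bijective_right := fun y => by
    -- Put `T x = (d x)⁻¹ • x`. Compatibility gives `T (g_y x) = (d y)⁻¹ • T x`, so injectivity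
    -- passes from `T` to `g_y`.
    refine Finite.injective_iff_bijective.mp fun x x' h => hT ?_
    have key : ∀ x : X, (d ((d (d x • y))⁻¹ • x))⁻¹ • (d (d x • y))⁻¹ • x =
        (d y)⁻¹ • (d x)⁻¹ • x := fun x => by
      rw [← mul_smul, ← mul_smul, ← mul_inv_rev, ← mul_inv_rev, hd x y]
    have := congrArg (fun z => (d z)⁻¹ • z) h
    simp only [key] at this
    exact MulAction.injective _ this

theorem Solution.permutationGroup_ofAction {X : Type u} {G : Type*} [Group G] [MulAction G X]
    [Finite X] [Nonempty X] (d : X → G)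
    (hd : ∀ x y, d x * d y = d (d x • y) * d ((d (d x • y))⁻¹ • x))
    (hT : Function.Injective fun x => (d x)⁻¹ • x) (hsurj : Function.Surjective d) :
    (Solution.ofAction d hd hT).permutationGroup = (MulAction.toPermHom G X).range := by
  have : Set.range (Solution.ofAction d hd hT).f = ((MulAction.toPermHom G X).range : Set _) := by
    have hf : ∀ x, (Solution.ofAction d hd hT).f x = MulAction.toPermHom G X (d x) :=
      fun x => Equiv.ext fun y => rfl
    ext σ
    simp only [Set.mem_range, SetLike.mem_coe, MonoidHom.mem_range, hf]
    exact ⟨fun ⟨x, h⟩ => ⟨d x, h⟩, fun ⟨g, h⟩ => (hsurj g).imp fun x hx => by rw [hx, h]⟩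
  rw [Solution.permutationGroup, this, Subgroup.closure_eq]

end YangBaxter

/-- A finite group with a bijective 1-cocycle into a module is an IYB-group. -/
theorem IsIYBGroup.of_bijective_cocycle {G : Type u} [Group G] [Finite G] {A : Type u}
    [AddCommGroup A] (ρ : G →* AddMonoid.End A) (δ : G → A) (hδ : Function.Bijective δ)
    (hc : ∀ g h, δ (g * h) = δ g + ρ g (δ h)) : IsIYBGroup G := by
  let i1 : DistribMulAction G A := DistribMulAction.compHom A ρ
  have hc : ∀ g h, δ (g * h) = δ g + g • δ h := hc
  have h1 : δ 1 = 0 := by simpa using hc 1 1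
  have hinv : ∀ g, g⁻¹ • δ g = - δ g⁻¹ := fun g => by
    rw [eq_neg_iff_add_eq_zero, add_comm, ← hc, inv_mul_cancel, h1]
  let e : G ≃ A := Equiv.ofBijective δ hδ
  have hfin : Finite A := Finite.of_equiv G e
  -- The regular summand `G` makes the action faithful even if `ρ` is not; `d` will be `1` on it.
  let i2 : MulAction G (A ⊕ G) :=
    { smul := fun g => Sum.map (g • ·) (g * ·)
      one_smul := fun x => by
        change Sum.map _ _ x = x
        cases x <;> simp
      mul_smul := fun g h x => by
        change Sum.map _ _ x = Sum.map _ _ (Sum.map _ _ x)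
        cases x <;> simp [mul_smul, mul_assoc] }
  have sl : ∀ (g : G) (a : A), g • (Sum.inl a : A ⊕ G) = Sum.inl (g • a) := fun _ _ => rfl
  have sr : ∀ (g h : G), g • (Sum.inr h : A ⊕ G) = Sum.inr (g * h) := fun _ _ => rfl
  let D : A ⊕ G → A := Sum.elim id 0
  have hD : ∀ (g : G) x, D (g • x) = g • D x := fun g x => by
    cases x <;> simp [D, sl, sr]
  let d : A ⊕ G → G := fun x => e.symm (D x)
  have hdD : ∀ x, δ (d x) = D x := fun x => e.apply_symm_apply _
  have hsurj : Function.Surjective d := fun g => ⟨Sum.inl (δ g), e.symm_apply_apply g⟩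
  have hd : ∀ x y, d x * d y = d (d x • y) * d ((d (d x • y))⁻¹ • x) := fun x y => by
    apply hδ.1
    rw [hc, hc, hdD, hdD, hdD, hdD, hD, hD, smul_inv_smul, add_comm]
  have hT : Function.Injective fun x => (d x)⁻¹ • x := fun x y h => by
    have h' := congrArg D h
    simp only [hD] at h'
    rw [← hdD, ← hdD, hinv, hinv, neg_inj] at h'
    have : d x = d y := inv_injective (hδ.1 h')
    simp only [this] at h
    exact MulAction.injective _ h
  refine ⟨A ⊕ G, YangBaxter.Solution.ofAction d hd hT, ⟨?_⟩⟩
  rw [YangBaxter.Solution.permutationGroup_ofAction d hd hT hsurj]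
  refine MonoidHom.ofInjective fun g h hgh => ?_
  have := congrArg (fun σ : Equiv.Perm (A ⊕ G) => σ (Sum.inr 1)) hgh
  simpa [sr] using this

/-! ### Transitive affine actions and the reduction to one prime -/

/-- `G` acts transitively by affine maps on an abelian group with `n` elements; the action is
given by its linear part `ρ` and by the orbit map `δ` of the origin, a surjective 1-cocycle. -/
def HasTransitiveAffineAction (G : Type u) [Group G] (n : ℕ) : Prop :=
  ∃ (A : Type u) (_ : AddCommGroup A) (ρ : G →* AddMonoid.End A) (δ : G → A),
    Nat.card A = n ∧ Function.Surjective δ ∧ ∀ g h, δ (g * h) = δ g + ρ g (δ h)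

theorem HasTransitiveAffineAction.of_surjective {G H : Type u} [Group G] [Group H] {n : ℕ}
    (hH : HasTransitiveAffineAction H n) (f : G →* H) (hf : Function.Surjective f) :
    HasTransitiveAffineAction G n := by
  obtain ⟨A, _, ρ, δ, hn, hs, hc⟩ := hH
  exact ⟨A, _, ρ.comp f, δ ∘ f, hn, hs.comp hf, fun g h => by simp [hc]⟩

section Cocycle

variable {G A : Type*} [Group G] [AddCommGroup A] (ρ : G →* AddMonoid.End A) (δ : G → A)

theorem cocycle_one (hc : ∀ g h, δ (g * h) = δ g + ρ g (δ h)) : δ 1 = 0 := by simpa using hc 1 1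

theorem cocycle_eq_iff (hc : ∀ g h, δ (g * h) = δ g + ρ g (δ h)) (g h : G) :
    δ g = δ h ↔ δ (g⁻¹ * h) = 0 := by
  have e := hc g (g⁻¹ * h)
  rw [mul_inv_cancel_left] at e
  constructor
  · intro hgh
    rw [hgh, left_eq_add] at e
    have h1 : ρ g⁻¹ (ρ g (δ (g⁻¹ * h))) = δ (g⁻¹ * h) := by
      change (ρ g⁻¹ * ρ g) _ = _
      rw [← map_mul, inv_mul_cancel, map_one]
      rfl
    rw [← h1, e, map_zero]
  · intro h0
    rw [e, h0, map_zero, add_zero]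

/-- The stabilizer of the origin under the affine action attached to a 1-cocycle. -/
def cocycleStabilizer (hc : ∀ g h, δ (g * h) = δ g + ρ g (δ h)) :
    Subgroup G where
  carrier := {g | δ g = 0}
  one_mem' := cocycle_one ρ δ hc
  mul_mem' := fun {a b} ha hb => by
    simp only [Set.mem_ofPred_eq] at ha hb ⊢
    rw [hc, ha, hb, map_zero, add_zero]
  inv_mem' := fun {a} ha => by
    simp only [Set.mem_ofPred_eq] at ha ⊢
    have := (cocycle_eq_iff ρ δ hc a 1).1 (by rw [ha, cocycle_one ρ δ hc])
    rwa [mul_one] at this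

theorem index_cocycleStabilizer (hc : ∀ g h, δ (g * h) = δ g + ρ g (δ h))
    (hs : Function.Surjective δ) :
    (cocycleStabilizer ρ δ hc).index = Nat.card A := by
  have key : ∀ g h : G, g⁻¹ * h ∈ cocycleStabilizer ρ δ hc ↔ δ g = δ h := fun g h =>
    (cocycle_eq_iff ρ δ hc g h).symm
  refine Nat.card_eq_of_bijective
    (Quotient.lift δ fun g h hgh => (key g h).1 (QuotientGroup.leftRel_apply.1 hgh)) ⟨?_, ?_⟩
  · rintro ⟨g⟩ ⟨h⟩ hgh
    exact Quotient.sound (QuotientGroup.leftRel_apply.2 ((key g h).2 hgh))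
  · intro a
    obtain ⟨g, rfl⟩ := hs a
    exact ⟨Quotient.mk _ g, rfl⟩

end Cocycle

/-- It suffices to construct transitive affine actions one prime at a time. -/
theorem IsIYBGroup.of_forall_primeFactors {G : Type u} [Group G] [Finite G]
    (h : ∀ p : ℕ, p.Prime → HasTransitiveAffineAction G (p ^ (Nat.card G).factorization p)) :
    IsIYBGroup G := by
  choose A _ ρ δ hn hs hc using fun p : (Nat.card G).primeFactors =>
    h p (Nat.prime_of_mem_primeFactors p.2)
  let P : G →* AddMonoid.End (∀ p, A p) :=
    { toFun := fun g =>
        { toFun := fun a p => ρ p g (a p)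
          map_zero' := by ext; simp
          map_add' := fun a b => by ext; simp }
      map_one' := by ext; simp; rfl
      map_mul' := fun g g' => by ext; simp; rfl }
  let Δ : G → ∀ p, A p := fun g p => δ p g
  have hΔ : ∀ g g', Δ (g * g') = Δ g + P g (Δ g') := fun g g' => by
    ext p
    exact hc p g g'
  have hcard : Nat.card (∀ p, A p) = Nat.card G := by
    rw [Nat.card_pi]
    simp only [hn]
    rw [Finset.prod_coe_sort (Nat.card G).primeFactors
      (fun p => p ^ (Nat.card G).factorization p)]
    exact Nat.prod_factorization_pow_eq_self Nat.card_pos.ne'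
  have hfin : Finite (∀ p, A p) := Nat.finite_of_card_ne_zero (by rw [hcard]; exact Nat.card_pos.ne')
  have hbot : cocycleStabilizer P Δ hΔ = ⊥ := by
    rw [← Subgroup.card_eq_one]
    by_contra hne
    obtain ⟨q, hq, hqd⟩ := Nat.exists_prime_and_dvd hne
    have hqm : q ∈ (Nat.card G).primeFactors := Nat.mem_primeFactors.2
      ⟨hq, hqd.trans (Subgroup.card_subgroup_dvd_card _), Nat.card_pos.ne'⟩
    -- The index of `K` is the full `q`-part of `|G|`, so `q` cannot divide the order of `K`.
    let K := cocycleStabilizer (ρ ⟨q, hqm⟩) (δ ⟨q, hqm⟩) (hc ⟨q, hqm⟩)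
    have hle : cocycleStabilizer P Δ hΔ ≤ K := fun g hg => congrFun hg ⟨q, hqm⟩
    have hqK : q ∣ Nat.card K := hqd.trans (Subgroup.card_dvd_of_le hle)
    have hK := K.index_mul_card
    rw [index_cocycleStabilizer _ _ _ (hs _), hn] at hK
    apply Nat.pow_succ_factorization_not_dvd (n := Nat.card G) Nat.card_pos.ne' hq
    rw [pow_succ]
    nth_rw 2 [← hK]
    exact mul_dvd_mul_left _ hqK
  refine IsIYBGroup.of_bijective_cocycle P Δ
    (Function.Injective.bijective_of_nat_card_le (fun g g' hgg => ?_) hcard.le) hΔ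
  have : g⁻¹ * g' ∈ cocycleStabilizer P Δ hΔ := (cocycle_eq_iff P Δ hΔ g g').1 hgg
  rw [hbot, Subgroup.mem_bot, inv_mul_eq_one] at this
  exact this

/-! ### Affine actions from groups of class at most two -/

/-- A bilinear map `β` with central values whose antisymmetrization is the commutator turns a group
of class at most two into an abelian group, and yields an affine action of `P ⋊ H`. -/
theorem hasTransitiveAffineAction_semidirectProduct {P H : Type u} [Group P] [Group H]
    {Z : Type*} [CommGroup Z] (φ : H →* MulAut P) (ι : Z →* P) (hι : ∀ z u, ι z * u = u * ι z)
    (β : P →* P →* Z) (hl : ∀ z u, β (ι z) u = 1) (hr : ∀ u z, β u (ι z) = 1)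
    (hβ : ∀ u v, ⁅u, v⁆ = ι (β u v / β v u))
    (hφ : ∀ h u v, φ h (ι (β u v)) = ι (β (φ h u) (φ h v))) :
    HasTransitiveAffineAction (P ⋊[φ] H) (Nat.card P) := by
  have hz : ∀ (x y : P) (c : Z), x * ι c * y = x * y * ι c := fun x y c => by
    rw [mul_assoc, mul_assoc, hι]
  have hzz : ∀ (x : P) (c d : Z), x * ι c * ι d = x * ι (c * d) :=
    fun x c d => by rw [mul_assoc, map_mul]
  let i : AddCommGroup P :=
    { add := fun u v => u * v * ι (β u v)⁻¹
      zero := (1 : P)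
      neg := fun u => u⁻¹ * ι (β u⁻¹ u)
      nsmul := @nsmulRec P ⟨(1 : P)⟩ ⟨fun u v => u * v * ι (β u v)⁻¹⟩
      zsmul := @zsmulRec P ⟨(1 : P)⟩ ⟨fun u v => u * v * ι (β u v)⁻¹⟩
        ⟨fun u => u⁻¹ * ι (β u⁻¹ u)⟩ (@nsmulRec P ⟨(1 : P)⟩ ⟨fun u v => u * v * ι (β u v)⁻¹⟩)
      add_assoc := fun u v w => by
        change u * v * ι (β u v)⁻¹ * w * ι (β (u * v * _) w)⁻¹ =
          u * (v * w * ι (β v w)⁻¹) * ι (β u (v * w * _))⁻¹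
        simp only [map_mul β, map_mul (β u), MonoidHom.mul_apply, hl, hr, mul_one, ← mul_assoc]
        rw [hz _ w, hzz, hzz]
        congr 2
        simp only [mul_inv_rev, mul_assoc, mul_comm]
      zero_add := fun u => by
        change 1 * u * ι (β 1 u)⁻¹ = u
        simp
      add_zero := fun u => by
        change u * 1 * ι (β u 1)⁻¹ = u
        simp
      neg_add_cancel := fun u => by
        change u⁻¹ * ι (β u⁻¹ u) * u * ι (β (u⁻¹ * ι (β u⁻¹ u)) u)⁻¹ = 1
        rw [map_mul β, MonoidHom.mul_apply, hl, mul_one, hz, hzz, inv_mul_cancel, mul_inv_cancel,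
          map_one, mul_one]
      add_comm := fun u v => by
        change u * v * ι (β u v)⁻¹ = v * u * ι (β v u)⁻¹
        have h1 : u * v = v * u * ι (β u v / β v u) := by
          rw [← hι, ← hβ, commutatorElement_def]
          group
        rw [h1, hzz]
        congr 2
        rw [div_eq_mul_inv, mul_right_comm, mul_inv_cancel, one_mul] }
  have hadd : ∀ u v : P, u + v = u * v * ι (β u v)⁻¹ := fun _ _ => rfl
  have hβr : ∀ (u v : P) z, β u (v * ι z) = β u v := fun u v z => by rw [map_mul, hr, mul_one]
  have hβl : ∀ (u v : P) z, β (u * ι z) v = β u v := fun u v z => by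
    rw [map_mul, MonoidHom.mul_apply, hl, mul_one]
  -- The linear part of the affine map `v ↦ u * φ h v` attached to `(u, h)`: the factor `β u (φ h
  -- v)` cancels the correction in the new addition.
  let f : P ⋊[φ] H → P → P := fun g v => φ g.right v * ι (β g.left (φ g.right v))
  have hfadd : ∀ g u v, f g (u + v) = f g u + f g v := fun g u v => by
    simp only [f, hadd, map_mul (φ g.right), map_inv, hφ]
    rw [← map_inv ι, ← map_inv ι, hβr, hβr, hβl, map_mul (β g.left), ← mul_assoc,
      hz _ (φ g.right v), hzz, hzz,
      hzz, mul_comm ((β (φ g.right u)) (φ g.right v))⁻¹, mul_assoc (β g.left _)]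
  have hfmul : ∀ g g' v, f (g * g') v = f g (f g' v) := fun g g' v => by
    simp only [f, SemidirectProduct.mul_right, SemidirectProduct.mul_left, map_mul φ,
      MulAut.mul_apply, map_mul (φ g.right), hφ, hβr, hzz, map_mul β, MonoidHom.mul_apply]
    rw [mul_comm (β g.left _)]
  let ρ : P ⋊[φ] H →* AddMonoid.End P :=
    { toFun := fun g => AddMonoidHom.mk' (f g) (hfadd g)
      map_one' := by
        ext v
        change φ 1 v * ι (β 1 (φ 1 v)) = v
        simp
      map_mul' := fun g g' => by
        ext v
        exact hfmul g g' v }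
  refine ⟨P, i, ρ, fun g => g.left, rfl, fun u => ⟨⟨u, 1⟩, rfl⟩, fun g g' => ?_⟩
  change g.left * φ g.right g'.left = g.left + f g g'.left
  simp only [f, hadd, hβr, ← mul_assoc, hzz, mul_inv_cancel, map_one, mul_one]

/-- The commutator map of a group of class at most two, as a bilinear map to the centre. -/
theorem exists_commutatorHom {P : Type u} [Group P] (h : ∀ u v w : P, Commute ⁅u, v⁆ w) :
    ∃ (Z : Type u) (_ : CommGroup Z) (ι : Z →* P) (κ : P →* P →* Z), Function.Injective ι ∧
      (∀ z u, ι z * u = u * ι z) ∧ ∀ u v, ι (κ u v) = ⁅u, v⁆ := by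
  let _ : CommGroup (Subgroup.center P) :=
    { (inferInstance : Group (Subgroup.center P)) with
      mul_comm := fun a b => Subtype.ext (Subgroup.mem_center_iff.1 b.2 a) }
  have hc : ∀ u v : P, ⁅u, v⁆ ∈ Subgroup.center P := fun u v =>
    Subgroup.mem_center_iff.2 fun g => ((h u v g).eq).symm
  have hr : ∀ u v w : P, ⁅u, v * w⁆ = ⁅u, v⁆ * ⁅u, w⁆ := fun u v w => by
    have : ⁅u, v * w⁆ = ⁅u, v⁆ * (v * ⁅u, w⁆ * v⁻¹) := by
      simp only [commutatorElement_def]; group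
    rw [this, ← (h u w v).eq, mul_inv_cancel_right]
  have hl : ∀ u v w : P, ⁅u * v, w⁆ = ⁅u, w⁆ * ⁅v, w⁆ := fun u v w => by
    rw [← commutatorElement_inv w, hr, mul_inv_rev, commutatorElement_inv,
      commutatorElement_inv, (h v w _).eq]
  refine ⟨Subgroup.center P, inferInstance, (Subgroup.center P).subtype,
    MonoidHom.mk' (fun u => MonoidHom.mk' (fun v => ⟨⁅u, v⁆, hc u v⟩)
      fun v w => Subtype.ext (hr u v w))
      fun u v => MonoidHom.ext fun w => Subtype.ext (hl u v w),
    Subtype.val_injective, fun z u => (Subgroup.mem_center_iff.1 z.2 u).symm, fun u v => rfl⟩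

/-- **Baer's trick**: a group `P` of odd order and class at most two carries an addition which is
invariant under all automorphisms. -/
theorem hasTransitiveAffineAction_semidirectProduct_of_odd {P H : Type u} [Group P] [Group H]
    (φ : H →* MulAut P) (h : ∀ u v w : P, Commute ⁅u, v⁆ w) (hodd : Odd (Nat.card P)) :
    HasTransitiveAffineAction (P ⋊[φ] H) (Nat.card P) := by
  obtain ⟨Z, _, ι, κ, hinj, hι, hκ⟩ := exists_commutatorHom h
  obtain ⟨m, hm⟩ := hodd
  have hκl : ∀ z u, κ (ι z) u = 1 := fun z u => hinj <| by
    rw [hκ, map_one, commutatorElement_eq_one_iff_mul_comm, hι]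
  have hκr : ∀ u z, κ u (ι z) = 1 := fun u z => hinj <| by
    rw [hκ, map_one, commutatorElement_eq_one_iff_mul_comm, hι]
  have hκs : ∀ u v, κ v u = (κ u v)⁻¹ := fun u v => hinj <| by
    rw [map_inv, hκ, hκ, commutatorElement_inv]
  -- As `|P| = 2m + 1`, the exponent `m + 1` is the inverse of 2 modulo `|P|`.
  refine hasTransitiveAffineAction_semidirectProduct φ ι hι (κ ^ (m + 1)) ?_ ?_ ?_ ?_
  · intro z u
    rw [MonoidHom.pow_apply, MonoidHom.pow_apply, hκl, one_pow]
  · intro u z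
    rw [MonoidHom.pow_apply, MonoidHom.pow_apply, hκr, one_pow]
  · intro u v
    rw [MonoidHom.pow_apply, MonoidHom.pow_apply, MonoidHom.pow_apply, MonoidHom.pow_apply, hκs u v,
      inv_pow, div_inv_eq_mul, ← pow_add, map_pow, hκ,
      show m + 1 + (m + 1) = Nat.card P + 1 by omega, pow_succ, pow_card_eq_one', one_mul]
  · intro g u v
    rw [MonoidHom.pow_apply, MonoidHom.pow_apply, MonoidHom.pow_apply, MonoidHom.pow_apply, map_pow,
      map_pow, map_pow, hκ, hκ, map_commutatorElement]

/-- An alternating bilinear map on a finite abelian group is the antisymmetrization of a bilinear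
map. -/
theorem exists_div_eq_of_alternating {Q Z : Type*} [CommGroup Q] [Finite Q] [CommGroup Z]
    (c : Q →* Q →* Z) (hc : ∀ u, c u u = 1) :
    ∃ β : Q →* Q →* Z, ∀ u v, c u v = β u v / β v u := by
  obtain ⟨I, _, n, -, ⟨e⟩⟩ := CommGroup.equiv_prod_multiplicative_zmod_of_finite Q
  classical
  have hs : ∀ u v, c v u = (c u v)⁻¹ := fun u v => by
    have := hc (u * v)
    rw [map_mul c, MonoidHom.mul_apply, map_mul, map_mul, hc, hc, one_mul, mul_one] at this
    exact eq_inv_of_mul_eq_one_right this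
  let π : I → Q →* Q := fun i => e.symm.toMonoidHom.comp
    ((MonoidHom.mulSingle _ i).comp ((Pi.evalMonoidHom _ i).comp e.toMonoidHom))
  have hπ : ∀ u, ∏ i, π i u = u := fun u => by
    change ∏ i, e.symm (Pi.mulSingle i (e u i)) = u
    rw [← map_prod, Finset.univ_prod_mulSingle, e.symm_apply_apply]
  have hdiag : ∀ i u v, c (π i u) (π i v) = 1 := fun i u v => by
    obtain ⟨g, hg⟩ := IsCyclic.exists_generator (α := Multiplicative (ZMod (n i)))
    obtain ⟨a, ha⟩ := Subgroup.mem_zpowers_iff.1 (hg (e u i))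
    obtain ⟨b, hb⟩ := Subgroup.mem_zpowers_iff.1 (hg (e v i))
    change c (e.symm (Pi.mulSingle i (e u i))) (e.symm (Pi.mulSingle i (e v i))) = 1
    rw [← ha, ← hb, Pi.mulSingle_zpow, Pi.mulSingle_zpow, map_zpow, map_zpow, map_zpow, map_zpow,
      MonoidHom.zpow_apply, hc, one_zpow, one_zpow]
  let r := Fintype.equivFin I
  -- The strictly upper triangular part of `c` for an ordering of the cyclic factors. Diagonal
  -- blocks vanish, since an alternating map on a cyclic group is trivial; lower blocks come from
  -- antisymmetry.
  let β : Q →* Q →* Z := ∏ i, ∏ j, if r i < r j then (c.comp (π i)).compl₂ (π j) else 1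
  have hβ : ∀ u v, β u v = ∏ i, ∏ j, if r i < r j then c (π i u) (π j v) else 1 := fun u v => by
    simp only [β, MonoidHom.finsetProd_apply]
    refine Finset.prod_congr rfl fun i _ => Finset.prod_congr rfl fun j _ => ?_
    split_ifs <;> simp
  refine ⟨β, fun u v => ?_⟩
  rw [hβ, hβ v u, Finset.prod_comm (f := fun i j => if r i < r j then c (π i v) (π j u) else 1)]
  simp only [← Finset.prod_div_distrib]
  have hc' : c u v = ∏ i, ∏ j, c (π i u) (π j v) := by
    calc c u v = c (∏ i, π i u) (∏ j, π j v) := by rw [hπ, hπ]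
      _ = _ := by
        rw [map_prod c, MonoidHom.finsetProd_apply]
        exact Finset.prod_congr rfl fun i _ => map_prod _ _ _
  rw [hc']
  refine Finset.prod_congr rfl fun i _ => Finset.prod_congr rfl fun j _ => ?_
  rw [hs (π i u) (π j v)]
  rcases lt_trichotomy (r i) (r j) with h | h | h
  · simp [h, h.not_gt]
  · rw [r.injective h, hdiag]
    simp
  · simp [h, h.not_gt]

/-- A finite group of class at most two acts regularly by affine maps on an abelian group. -/
theorem hasTransitiveAffineAction_of_class_two {P : Type u} [Group P] [Finite P]
    (h : ∀ u v w : P, Commute ⁅u, v⁆ w) : HasTransitiveAffineAction P (Nat.card P) := by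
  obtain ⟨Z, _, ι, κ, hinj, hι, hκ⟩ := exists_commutatorHom h
  have hκl : ∀ x ∈ Subgroup.center P, ∀ u, κ x u = 1 := fun x hx u => hinj <| by
    rw [hκ, map_one, commutatorElement_eq_one_iff_mul_comm, Subgroup.mem_center_iff.1 hx]
  have hκr : ∀ x ∈ Subgroup.center P, ∀ u, κ u x = 1 := fun x hx u => hinj <| by
    rw [hκ, map_one, commutatorElement_eq_one_iff_mul_comm, Subgroup.mem_center_iff.1 hx]
  let _ : CommGroup (P ⧸ Subgroup.center P) :=
    { (inferInstance : Group (P ⧸ Subgroup.center P)) with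
      mul_comm := fun a b => by
        obtain ⟨u, rfl⟩ := QuotientGroup.mk_surjective a
        obtain ⟨v, rfl⟩ := QuotientGroup.mk_surjective b
        refine QuotientGroup.eq.2 (Subgroup.mem_center_iff.2 fun g => ?_)
        have := h v⁻¹ u⁻¹ g
        rw [commutatorElement_def, inv_inv, inv_inv] at this
        change g * ((u * v)⁻¹ * (v * u)) = (u * v)⁻¹ * (v * u) * g
        rw [mul_inv_rev, ← mul_assoc (v⁻¹ * u⁻¹), this.eq] }
  let c : P ⧸ Subgroup.center P →* P ⧸ Subgroup.center P →* Z :=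
    QuotientGroup.lift _ (MonoidHom.mk'
      (fun u => QuotientGroup.lift _ (κ u) fun x hx => hκr x hx u)
      fun u v => QuotientGroup.monoidHom_ext _ (by
        ext w
        change κ (u * v) w = κ u w * κ v w
        rw [map_mul, MonoidHom.mul_apply]))
      fun x hx => QuotientGroup.monoidHom_ext _ (by ext w; exact hκl x hx w)
  have hc : ∀ u v : P, c u v = κ u v := fun u v => rfl
  obtain ⟨β, hβ⟩ := exists_div_eq_of_alternating c fun x => by
    obtain ⟨u, rfl⟩ := QuotientGroup.mk_surjective x
    rw [hc]
    apply hinj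
    rw [hκ, map_one, commutatorElement_self]
  have hmk : ∀ z, ((ι z : P) : P ⧸ Subgroup.center P) = 1 := fun z =>
    (QuotientGroup.eq_one_iff _).2 (Subgroup.mem_center_iff.2 fun g => (hι z g).symm)
  let q := QuotientGroup.mk' (Subgroup.center P)
  -- This `β` depends on a choice of cyclic decomposition and need not be equivariant, hence the
  -- trivial `H`.
  have := hasTransitiveAffineAction_semidirectProduct (H := PUnit.{u + 1})
    (1 : PUnit →* MulAut P) ι hι
    ((β.comp q).compl₂ q) (fun z u => by simp [q, hmk]) (fun z u => by simp [q, hmk])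
    (fun u v => by rw [← hκ, ← hc, hβ]; rfl) (fun _ _ _ => rfl)
  exact this.of_surjective SemidirectProduct.inl fun g => ⟨g.left, by ext; rfl⟩

/-! ### Ring identities for quadratic elements -/

/-- In a ring where `n` is nilpotent and `m` is cancellable, `(1 + n) ^ m = 1` forces `n = 0`. -/
theorem eq_zero_of_isNilpotent_of_one_add_pow_eq_one {E : Type*} [Ring E] {m : ℕ}
    (hm : ∀ e : E, (m : E) * e = 0 → e = 0) {n : E} (hn : IsNilpotent n)
    (h : (1 + n) ^ m = 1) : n = 0 := by
  have key : ∀ k : ℕ, ∃ w, (1 + n) ^ k = 1 + k * n + w * n ^ 2 := fun k => by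
    induction k with
    | zero => exact ⟨0, by simp⟩
    | succ k ih =>
      obtain ⟨w, hw⟩ := ih
      refine ⟨w + k + w * n, ?_⟩
      rw [pow_succ, hw]
      push_cast
      noncomm_ring
  obtain ⟨w, hw⟩ := key m
  obtain ⟨r, hr⟩ := hn
  -- Multiplying `m n + w n² = 0` by `n ^ r` leaves `m n ^ (r + 1) = 0`.
  have step : ∀ r, n ^ (r + 2) = 0 → n ^ (r + 1) = 0 := fun r hr => by
    apply hm
    have h1 : (m : E) * n + w * n ^ 2 = 0 := by
      rw [hw, add_assoc, add_eq_left] at h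
      exact h
    have h2 := congrArg (· * n ^ r) h1
    simp only [add_mul, zero_mul, mul_assoc, ← pow_add, ← pow_succ'] at h2
    rw [add_comm 2 r, hr, mul_zero, add_zero] at h2
    exact h2
  induction r with
  | zero =>
    have : (1 : E) = 0 := by simpa using hr
    rw [← one_mul n, this, zero_mul]
  | succ r ih =>
    rcases r with _ | r
    · simpa using hr
    · exact ih (step r hr)

theorem natCast_mul_cancel_of_coprime {E : Type*} [Ring E] {q m : ℕ} (hq : (q : E) = 0)
    (hmq : Nat.Coprime m q) (e : E) (h : (m : E) * e = 0) : e = 0 := by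
  have hu : (1 : ℤ) = m * m.gcdA q + q * m.gcdB q := by
    rw [← Nat.gcd_eq_gcd_ab, hmq.gcd_eq_one, Nat.cast_one]
  have hu' : (1 : E) = (m.gcdA q : E) * m + m.gcdB q * q := by
    have := congrArg (Int.cast : ℤ → E) hu
    push_cast at this
    rw [this, Nat.cast_comm, Nat.cast_comm (q : ℕ)]
  rw [← one_mul e, hu', hq, mul_zero, add_zero, mul_assoc, h, mul_zero]

/-- Conjugation by `τ` sends `σ` to `ζσ` and fixes `σ + σ⁻¹`, whence `(ζ - 1)(ζσ² - 1) = 0`.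
Conjugating once more and comparing gives `(ζ - 1)²(ζ + 1) = 0`. Since `ζ` has odd exponent, `2(ζ -
1)² = 0`; so `ζ` is unipotent of exponent prime to the characteristic, hence trivial. -/
theorem eq_one_of_commutator_relation {E : Type*} [Ring E] {m : ℕ} (hm : Odd m)
    (hm' : ∀ e : E, (m : E) * e = 0 → e = 0) (h2 : ∀ e : E, 2 * e = 0 → e = 0)
    {ζ ζ' σ σ' τ τ' : E} (hζ : ζ * ζ' = 1) (hσ : σ * σ' = 1) (hσ' : σ' * σ = 1)
    (hτ : τ * τ' = 1) (hζσ : Commute ζ σ) (hζτ : Commute ζ τ)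
    (hrel : τ * σ = ζ * σ * τ) (htr : Commute τ (σ + σ')) (hpow : ζ ^ m = 1) : ζ = 1 := by
  have hζ' : ζ' * ζ = 1 := by
    have : ζ ^ (m - 1) = ζ' := by
      obtain ⟨k, rfl⟩ := hm
      rw [pow_succ] at hpow
      rw [Nat.add_sub_cancel, ← mul_one (ζ ^ _), ← hζ, ← mul_assoc, hpow, one_mul]
    rw [← this, ← pow_succ, Nat.sub_add_cancel hm.pos, hpow]
  have hζ'σ : ζ' * σ = σ * ζ' := by
    calc ζ' * σ = ζ' * (σ * ζ) * ζ' := by rw [mul_assoc, mul_assoc, hζ, mul_one]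
      _ = _ := by rw [← hζσ.eq, ← mul_assoc, hζ', one_mul]
  have h1 : τ * σ' = σ' * ζ' * τ := by
    calc τ * σ' = σ' * (ζ' * ζ) * σ * τ * σ' := by rw [hζ', mul_one, hσ', one_mul]
      _ = σ' * ζ' * (ζ * σ * τ) * σ' := by simp only [mul_assoc]
      _ = _ := by rw [← hrel, mul_assoc, mul_assoc τ, hσ, mul_one]
  have h3 : ζ * σ + σ' * ζ' = σ + σ' := by
    have := htr.eq
    rw [mul_add, hrel, h1, ← add_mul] at this
    have := congrArg (· * τ') this
    simpa only [mul_assoc, hτ, mul_one] using this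
  have h4 : ζ * ζ * (σ * σ) + 1 = ζ * (σ * σ) + ζ := by
    have := congrArg (fun e => ζ * (e * σ)) h3
    simp only [add_mul, mul_add, hσ', mul_one] at this
    rw [mul_assoc σ', hζ'σ, ← mul_assoc σ', hσ', one_mul, hζ] at this
    simpa only [mul_assoc] using this
  have h5 : ζ * ζ * ζ - ζ * ζ - ζ + 1 = 0 := by
    have e1 : τ * (σ * σ) = ζ * ζ * (σ * σ) * τ := by
      rw [← mul_assoc, hrel, mul_assoc, hrel]
      simp only [mul_assoc]
      rw [← mul_assoc σ ζ, ← hζσ.eq, mul_assoc]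
    have e2 := congrArg (fun e => τ * e * τ') h4
    have c1 : τ * (ζ * ζ * (σ * σ)) = ζ * ζ * (τ * (σ * σ)) := by
      rw [← mul_assoc, ← (hζτ.mul_left hζτ).eq, mul_assoc]
    have c2 : τ * (ζ * (σ * σ)) = ζ * (τ * (σ * σ)) := by
      rw [← mul_assoc, ← hζτ.eq, mul_assoc]
    simp only [mul_add, add_mul, mul_one, c1, c2, e1, ← hζτ.eq] at e2
    simp only [mul_assoc, hτ, mul_one] at e2
    simp only [mul_assoc] at h4
    have e3 : ζ * (ζ * (ζ * (ζ * (σ * σ)))) = ζ * (ζ * (ζ * (σ * σ))) + ζ * ζ * ζ - ζ * ζ := by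
      have := congrArg (fun e => ζ * (ζ * e)) h4
      simp only [mul_add, mul_one] at this
      rw [eq_sub_iff_add_eq, this]
      simp only [mul_assoc]
    rw [e3] at e2
    rw [sub_add_eq_add_sub, add_assoc, add_sub_assoc, add_right_inj] at e2
    rw [← sub_eq_zero] at e2
    rw [← e2]
    abel
  have h6 : (ζ - 1) ^ 2 * ζ = -(ζ - 1) ^ 2 := by
    rw [← sub_eq_zero, ← h5]
    noncomm_ring
  have h7 : ∀ k, (ζ - 1) ^ 2 * ζ ^ k = (-1) ^ k * (ζ - 1) ^ 2 := fun k => by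
    induction k with
    | zero => simp
    | succ k ih => rw [pow_succ ζ, ← mul_assoc, ih, mul_assoc, h6, pow_succ (-1 : E)]; simp
  have h8 : (ζ - 1) ^ 2 = 0 := by
    apply h2
    have := h7 m
    rw [hpow, hm.neg_one_pow, mul_one, neg_one_mul, eq_neg_iff_add_eq_zero, ← two_mul] at this
    exact this
  have := eq_zero_of_isNilpotent_of_one_add_pow_eq_one hm' ⟨2, h8⟩ (by simpa using hpow)
  exact sub_eq_zero.1 this

section Quadratic

variable {E : Type*} [Ring E] {a b : E}

/-- With `x = 1 + a`, `y = 1 + b`, `t = x y⁻¹`, the sum of `x t x⁻¹` and its inverse is `2 - (ab +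
ba)`, which commutes with both `a` and `b`. -/
theorem quadratic_commute_trace (ha : a * a = 0) (hb : b * b = 0) :
    Commute ((1 + a) * (1 - b)) ((1 + a) * ((1 + a) * (1 - b)) * (1 - a) +
      (1 + a) * ((1 + b) * (1 - a)) * (1 - a)) := by
  have ha' : ∀ e, a * (a * e) = 0 := fun e => by rw [← mul_assoc, ha, zero_mul]
  have hb' : ∀ e, b * (b * e) = 0 := fun e => by rw [← mul_assoc, hb, zero_mul]
  have h : (1 + a) * ((1 + a) * (1 - b)) * (1 - a) + (1 + a) * ((1 + b) * (1 - a)) * (1 - a) =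
      2 - (a * b + b * a) := by
    simp only [mul_add, add_mul, mul_sub, sub_mul, mul_assoc, mul_one, one_mul, ha, ha',
      mul_zero, zero_mul, ← one_add_one_eq_two (R := E)]
    abel
  rw [h]
  refine (Commute.ofNat_right _ 2).sub_right ?_
  rw [Commute, SemiconjBy]
  simp only [mul_add, add_mul, mul_sub, sub_mul, mul_assoc, mul_one, one_mul, ha, hb, ha', hb',
      mul_zero]
  abel

theorem quadratic_isNilpotent_of_commute (h2 : ∀ e : E, 2 * e = 0 → e = 0)
    (ha : a * a = 0) (hb : b * b = 0)
    (h : Commute ((1 + a) * (1 - b)) ((1 + a) * ((1 + a) * (1 - b)) * (1 - a))) :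
    IsNilpotent ((1 + a) * (1 - b) - 1) := by
  have ha' : ∀ e, a * (a * e) = 0 := fun e => by rw [← mul_assoc, ha, zero_mul]
  have hb' : ∀ e, b * (b * e) = 0 := fun e => by rw [← mul_assoc, hb, zero_mul]
  have hS : a * (b * a) + b * (a * b) - b * (a * (b * a)) + a * (b * (a * b))
      - a * (b * (a * (b * a))) = 0 := by
    apply h2
    have := sub_eq_zero.2 h.eq
    rw [← this, two_mul]
    simp only [mul_add, add_mul, mul_sub, sub_mul, mul_assoc, mul_one, one_mul, ha, hb, ha', hb',
      mul_zero, zero_mul]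
    abel
  have hA := congrArg (a * ·) hS
  simp only [mul_add, mul_sub, ha', mul_zero, zero_add, add_zero, sub_zero] at hA
  have hA2 := congrArg (· * a) hA
  simp only [mul_assoc, ha, mul_zero, sub_mul, sub_zero, zero_mul] at hA2
  rw [hA2, sub_zero] at hA
  have hB := congrArg (b * ·) hS
  simp only [mul_add, mul_sub, hb', hA, hA2, mul_zero, add_zero, sub_zero] at hB
  -- The words `abab` and `baba` both vanish by now, so every product of four factors from `a`, `b`,
  -- `ab` is zero.
  refine ⟨4, ?_⟩
  have e : (1 + a) * (1 - b) - 1 = a - b - a * b := by noncomm_ring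
  rw [e]
  simp only [pow_succ, pow_zero, mul_sub, sub_mul, mul_assoc, one_mul,
    ha, hb, ha', hA, hB, mul_zero, sub_zero, zero_sub, neg_zero, neg_mul]

end Quadratic

/-- Two elements `x`, `y` acting quadratically in odd characteristic: if the commutator `z` of
`t = x * y⁻¹` and its conjugate under `x` commutes with `x` and `y` and has odd order, and `t` is
`p`-regular, then `t` acts trivially. -/
theorem map_eq_one_of_quadratic {E M : Type*} [Ring E] [Group M] (φ : M →* E) {q m : ℕ}
    (hq : (q : E) = 0) (hq2 : Odd q) (hmq : Nat.Coprime m q) {x y t : M} (ht : t = x * y⁻¹)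
    (hx : (φ x - 1) ^ 2 = 0) (hy : (φ y - 1) ^ 2 = 0) (htm : t ^ m = 1)
    (hzx : Commute ⁅t, x * t * x⁻¹⁆ x) (hzy : Commute ⁅t, x * t * x⁻¹⁆ y)
    (hz : Odd (orderOf ⁅t, x * t * x⁻¹⁆)) (hzm : ⁅t, x * t * x⁻¹⁆ ^ m = 1) : φ t = 1 := by
  have h2 : ∀ e : E, 2 * e = 0 → e = 0 := fun e he =>
    natCast_mul_cancel_of_coprime (m := 2) hq (Nat.coprime_two_left.2 hq2) e (by simpa using he)
  have inv : ∀ g : M, φ g * φ g⁻¹ = 1 := fun g => by rw [← map_mul, mul_inv_cancel, map_one]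
  have inv' : ∀ g : M, φ g⁻¹ * φ g = 1 := fun g => by rw [← map_mul, inv_mul_cancel, map_one]
  have hinv : ∀ g : M, (φ g - 1) ^ 2 = 0 → φ g⁻¹ = 1 - (φ g - 1) := fun g hg => by
    have h1 : φ g * (1 - (φ g - 1)) = 1 := by
      generalize φ g = X at hg
      have : X * (1 - (X - 1)) = 1 - (X - 1) ^ 2 := by noncomm_ring
      rw [this, hg, sub_zero]
    calc φ g⁻¹ = φ g⁻¹ * (φ g * (1 - (φ g - 1))) := by rw [h1, mul_one]
      _ = _ := by rw [← mul_assoc, inv', one_mul]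
  have hxi := hinv x hx
  have hyi := hinv y hy
  rw [sq] at hx hy
  set z := ⁅t, x * t * x⁻¹⁆ with hzdef
  set a := φ x - 1 with ha
  set b := φ y - 1 with hb
  have hxa : φ x = 1 + a := by rw [ha]; abel
  have hyb : φ y = 1 + b := by rw [hb]; abel
  have hτ : φ t = (1 + a) * (1 - b) := by rw [ht, map_mul, hxa, hyi]
  have hτi : φ t⁻¹ = (1 + b) * (1 - a) := by
    rw [ht, mul_inv_rev, inv_inv, map_mul, hyb, hxi]
  have hσ : φ (x * t * x⁻¹) = (1 + a) * ((1 + a) * (1 - b)) * (1 - a) := by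
    rw [map_mul, map_mul, hxa, hτ, hxi]
  have hσi : φ (x * t * x⁻¹)⁻¹ = (1 + a) * ((1 + b) * (1 - a)) * (1 - a) := by
    rw [mul_inv_rev, mul_inv_rev, inv_inv, ← mul_assoc, map_mul, map_mul, hxa, hτi, hxi]
  have hzt : Commute z t := by rw [ht]; exact hzx.mul_right hzy.inv_right
  have hzs : Commute z (x * t * x⁻¹) := (hzx.mul_right hzt).mul_right hzx.inv_right
  have hrel : t * (x * t * x⁻¹) = z * (x * t * x⁻¹) * t := by
    rw [hzdef, commutatorElement_def]; group
  have htr := quadratic_commute_trace hx hy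
  rw [← hσ, ← hσi, ← hτ] at htr
  have hcop : Nat.Coprime (orderOf z) q :=
    Nat.Coprime.coprime_dvd_left (orderOf_dvd_of_pow_eq_one hzm) hmq
  have hz1 : φ z = 1 := eq_one_of_commutator_relation hz (natCast_mul_cancel_of_coprime hq hcop) h2
    (inv z) (inv _) (inv' _) (inv t) (hzs.map φ) (hzt.map φ)
    (by rw [← map_mul, hrel, map_mul, map_mul]) htr
    (by rw [← map_pow, pow_orderOf_eq_one, map_one])
  have hcomm : Commute (φ t) (φ (x * t * x⁻¹)) := by
    rw [Commute, SemiconjBy, ← map_mul, hrel, map_mul, map_mul, hz1, one_mul]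
  rw [hτ, hσ] at hcomm
  have hnil := quadratic_isNilpotent_of_commute h2 hx hy hcomm
  rw [← hτ] at hnil
  have := eq_zero_of_isNilpotent_of_one_add_pow_eq_one
    (natCast_mul_cancel_of_coprime hq hmq) hnil (by
      rw [add_sub_cancel, ← map_pow, htm, map_one])
  exact sub_eq_zero.1 this

/-! ### Self-centralizing normal subgroups and `p`-stability -/

/-- A finite soluble group has a normal subgroup of class at most two which contains its own
centralizer. -/
theorem exists_normal_class_two_centralizer_le {G : Type*} [Group G] [Finite G]
    (hG : Group.IsSolvable G) : ∃ F : Subgroup G, F.Normal ∧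
      (∀ a ∈ F, ∀ b ∈ F, ∀ c ∈ F, Commute ⁅a, b⁆ c) ∧ Subgroup.centralizer (F : Set G) ≤ F := by
  let S : Set (Subgroup G) := {F | F.Normal ∧ ∀ a ∈ F, ∀ b ∈ F, ∀ c ∈ F, Commute ⁅a, b⁆ c}
  have hS : S.Nonempty := ⟨⊥, inferInstance, by
    simp only [Subgroup.mem_bot]
    rintro _ rfl _ rfl _ rfl
    exact Commute.one_right _⟩
  obtain ⟨F, ⟨hF, hcl⟩, hmax⟩ := S.toFinite.exists_maximal hS
  refine ⟨F, hF, hcl, ?_⟩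
  by_contra hC
  obtain ⟨C, hC00, hCs⟩ : ∃ C : ℕ → Subgroup G, C 0 = Subgroup.centralizer (F : Set G) ∧
      ∀ n, C (n + 1) = ⁅C n, C n⁆ :=
    ⟨fun n => Nat.rec (Subgroup.centralizer (F : Set G)) (fun _ K => ⁅K, K⁆) n, rfl, fun _ => rfl⟩
  have hCn : ∀ n, (C n).Normal := fun n => by
    induction n with
    | zero => rw [hC00]; infer_instance
    | succ n ih => rw [hCs]; infer_instance
  have hC0 : ∀ n, C n ≤ Subgroup.centralizer (F : Set G) := fun n => by
    induction n with
    | zero => rw [hC00]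
    | succ n ih =>
      have := hCn n
      rw [hCs]
      exact (Subgroup.commutator_le_left _ _).trans ih
  have hCd : ∀ n, C n ≤ derivedSeries G n := fun n => by
    induction n with
    | zero => exact le_top
    | succ n ih => rw [hCs]; exact Subgroup.commutator_mono ih ih
  obtain ⟨N, hN⟩ := (Group.isSolvable_def G).1 hG
  -- The last term of the derived series of the centralizer not inside `F`; adjoining it to `F`
  -- keeps the class at most two, against maximality.
  obtain ⟨n, hD, hDD⟩ : ∃ n, ¬ C n ≤ F ∧ ⁅C n, C n⁆ ≤ F := by
    by_contra! h
    have : ∀ n, ¬ C n ≤ F := fun n => by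
      induction n with
      | zero => rwa [hC00]
      | succ n ih => rw [hCs]; exact h n ih
    exact this N ((hCd N).trans (hN ▸ bot_le))
  have hcom : ∀ x ∈ F, ∀ d ∈ C n, Commute x d := fun x hx d hd =>
    Subgroup.mem_centralizer_iff.1 (hC0 n hd) x hx
  have hDn := hCn n
  have hmem : ∀ g ∈ F ⊔ C n, ∃ a ∈ F, ∃ d ∈ C n, a * d = g := fun g hg =>
    Subgroup.mem_sup_of_normal_right.1 hg
  have hsup : F ⊔ C n ∈ S := by
    refine ⟨Subgroup.sup_normal F (C n), ?_⟩
    intro _ ha0 _ hb0 _ hc0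
    obtain ⟨a, ha, a', ha', rfl⟩ := hmem _ ha0
    obtain ⟨b, hb, b', hb', rfl⟩ := hmem _ hb0
    obtain ⟨c, hc, c', hc', rfl⟩ := hmem _ hc0
    have e : ⁅a * a', b * b'⁆ = ⁅a, b⁆ * ⁅a', b'⁆ := by
      have h1 := (hcom b hb a' ha').eq
      have h2 : a'⁻¹ * a⁻¹ = a⁻¹ * a'⁻¹ := ((hcom a ha a' ha').inv_inv).eq.symm
      have h3 : b'⁻¹ * b⁻¹ = b⁻¹ * b'⁻¹ := ((hcom b hb b' hb').inv_inv).eq.symm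
      have h4 : Commute (a⁻¹ * b⁻¹) (a' * b') :=
        (hcom _ (F.mul_mem (F.inv_mem ha) (F.inv_mem hb)) _ (mul_mem ha' hb'))
      have h5 : Commute b⁻¹ a'⁻¹ := (hcom b hb a' ha').inv_inv
      calc ⁅a * a', b * b'⁆ = a * (a' * b) * b' * (a'⁻¹ * a⁻¹) * (b'⁻¹ * b⁻¹) := by
            simp only [commutatorElement_def]; group
        _ = a * b * (a' * b') * a⁻¹ * (a'⁻¹ * b⁻¹) * b'⁻¹ := by
            rw [← h1, h2, h3]; simp only [mul_assoc]
        _ = a * b * ((a' * b') * (a⁻¹ * b⁻¹)) * a'⁻¹ * b'⁻¹ := by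
            rw [← h5.eq]; simp only [mul_assoc]
        _ = _ := by
            rw [← h4.eq]; simp only [commutatorElement_def, mul_assoc]
    have hab : ⁅a, b⁆ ∈ F :=
      Subgroup.commutator_le_left F F (Subgroup.commutator_mem_commutator ha hb)
    have hab' : ⁅a', b'⁆ ∈ ⁅C n, C n⁆ := Subgroup.commutator_mem_commutator ha' hb'
    rw [e]
    refine Commute.mul_left (Commute.mul_right (hcl _ ha _ hb _ hc) (hcom _ hab _ hc'))
      (Commute.mul_right ?_ (hcom _ (hDD hab') _ hc'))
    exact (hcom _ hc _ (Subgroup.commutator_le_left _ _ hab')).symm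
  exact hD (le_sup_right.trans (hmax hsup le_sup_left))

/-- A subgroup of class at most two is nilpotent. -/
theorem isNilpotent_of_class_two {G : Type*} [Group G] {F : Subgroup G}
    (h : ∀ a ∈ F, ∀ b ∈ F, ∀ c ∈ F, Commute ⁅a, b⁆ c) : Group.IsNilpotent F := by
  refine Subgroup.isNilpotent_of_lowerCentralSeries_eq_bot (n := 2) ?_
  change ⁅⁅F, F⁆, F⁆ = ⊥
  rw [Subgroup.commutator_eq_bot_iff_le_centralizer, Subgroup.commutator_le]
  exact fun a ha b hb => Subgroup.mem_centralizer_iff.2 fun c hc => (h a ha b hb c hc).eq.symm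

theorem class_two_of_nilpotencyClass_le {G : Type*} [Group G] {F : Subgroup G}
    (hF : Group.IsNilpotent F) (hc : Group.nilpotencyClass F ≤ 2) :
    ∀ a ∈ F, ∀ b ∈ F, ∀ c ∈ F, Commute ⁅a, b⁆ c := by
  have h : ⁅⁅F, F⁆, F⁆ = ⊥ := Subgroup.lowerCentralSeries_eq_bot_of_nilpotencyClass_le hc
  rw [Subgroup.commutator_eq_bot_iff_le_centralizer] at h
  exact fun a ha b hb c hc => (Subgroup.mem_centralizer_iff.1
    (h (Subgroup.commutator_mem_commutator ha hb)) c hc).symm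

/-- Sylow subgroups of nilpotent normal subgroups are normal in the whole group. -/
theorem normal_map_sylow {G : Type*} [Group G] [Finite G] (F : Subgroup G) [F.Normal]
    (hF : Group.IsNilpotent F) {q : ℕ} [Fact q.Prime] (Q : Sylow q F) :
    ((Q : Subgroup F).map F.subtype).Normal := by
  have h1 : (Q : Subgroup F).Normal :=
    Q.normal_of_normalizerCondition Group.normalizerCondition_of_isNilpotent
  have := Q.characteristic_of_normal h1
  infer_instance

/-- If `G` has no non-trivial normal `q`-subgroup, then `q` does not divide the order of a
nilpotent normal subgroup of `G`. -/
theorem not_dvd_card_of_isNilpotent {G : Type*} [Group G] [Finite G] (F : Subgroup G) [F.Normal]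
    (hF : Group.IsNilpotent F) {q : ℕ} [Fact q.Prime]
    (hq : ∀ D : Subgroup G, D.Normal → D ≤ F → IsPGroup q D → D = ⊥) : ¬ q ∣ Nat.card F := by
  intro hdvd
  obtain ⟨Q⟩ : Nonempty (Sylow q F) := inferInstance
  refine Q.ne_bot_of_dvd_card hdvd ?_
  have := hq _ (normal_map_sylow F hF Q) (Subgroup.map_subtype_le _) (Q.2.map _)
  rwa [Subgroup.map_eq_bot_iff_of_injective _ F.subtype_injective] at this

/-- **`p`-stability**: let `φ` be a faithful representation, in odd characteristic `p`, of a finite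
soluble group without non-trivial normal `p`-subgroups. Then no non-trivial element of a normal
subgroup of odd order acts quadratically. -/
theorem eq_one_of_quadratic {E M : Type*} [Ring E] [Group M] [Finite M]
    (hM : Group.IsSolvable M) (φ : M →* E) (hφ : Function.Injective φ) {p k : ℕ} [Fact p.Prime]
    (hp : Odd p) (hE : ((p ^ k : ℕ) : E) = 0)
    (hO : ∀ D : Subgroup M, D.Normal → IsPGroup p D → D = ⊥)
    (N : Subgroup M) [N.Normal] (hN : Odd (Nat.card N)) {x : M} (hxN : x ∈ N)
    (hx : (φ x - 1) ^ 2 = 0) : x = 1 := by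
  obtain ⟨F, hF, hcl, hC⟩ := exists_normal_class_two_centralizer_le hM
  have hpF : Nat.Coprime (Nat.card F) p := ((Nat.Prime.coprime_iff_not_dvd Fact.out).2
    (not_dvd_card_of_isNilpotent F (isNilpotent_of_class_two hcl) fun D h1 _ h2 => hO D h1 h2)).symm
  have hFpow : ∀ t ∈ F, t ^ Nat.card F = 1 := fun t ht => by
    exact congrArg Subtype.val (pow_card_eq_one' (x := (⟨t, ht⟩ : F)))
  have hN' : ∀ t ∈ N, Odd (orderOf t) := fun t ht =>
    Odd.of_dvd_nat hN (Subgroup.orderOf_dvd_natCard N ht)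
  -- Here `[x,u] = x (u x u⁻¹)⁻¹` is a `p'`-element built from two quadratic elements.
  have core : ∀ u ∈ F, Commute ⁅⁅x, u⁆, x * ⁅x, u⁆ * x⁻¹⁆ x →
      Commute ⁅⁅x, u⁆, x * ⁅x, u⁆ * x⁻¹⁆ u → Commute x u := by
    intro u hu hzx hzu
    have htF : ⁅x, u⁆ ∈ F := by
      rw [commutatorElement_def]
      exact F.mul_mem (hF.conj_mem u hu x) (F.inv_mem hu)
    have htN : ⁅x, u⁆ ∈ N := by
      rw [commutatorElement_def, mul_assoc, mul_assoc, ← mul_assoc u]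
      exact N.mul_mem hxN (‹N.Normal›.conj_mem _ (N.inv_mem hxN) u)
    have hy : (φ (u * x * u⁻¹) - 1) ^ 2 = 0 := by
      have h1 : φ u * φ u⁻¹ = 1 := by rw [← map_mul, mul_inv_cancel, map_one]
      have h2 : φ u⁻¹ * φ u = 1 := by rw [← map_mul, inv_mul_cancel, map_one]
      have : φ (u * x * u⁻¹) - 1 = φ u * (φ x - 1) * φ u⁻¹ := by
        rw [mul_sub, sub_mul, mul_one, h1, map_mul, map_mul]
      rw [this, sq]
      calc φ u * (φ x - 1) * φ u⁻¹ * (φ u * (φ x - 1) * φ u⁻¹) =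
            φ u * (φ x - 1) * (φ u⁻¹ * φ u) * (φ x - 1) * φ u⁻¹ := by simp only [mul_assoc]
        _ = φ u * (φ x - 1) ^ 2 * φ u⁻¹ := by rw [h2, mul_one, sq]; simp only [mul_assoc]
        _ = 0 := by rw [hx, mul_zero, zero_mul]
    have hsF := hF.conj_mem _ htF x
    have hsN := ‹N.Normal›.conj_mem _ htN x
    have hzF : ⁅⁅x, u⁆, x * ⁅x, u⁆ * x⁻¹⁆ ∈ F :=
      Subgroup.commutator_le_left F F (Subgroup.commutator_mem_commutator htF hsF)
    have hzN : ⁅⁅x, u⁆, x * ⁅x, u⁆ * x⁻¹⁆ ∈ N :=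
      Subgroup.commutator_le_left N N (Subgroup.commutator_mem_commutator htN hsN)
    have := map_eq_one_of_quadratic φ hE hp.pow (hpF.pow_right k)
      (x := x) (y := u * x * u⁻¹) (t := ⁅x, u⁆)
      (by rw [commutatorElement_def]; group) hx hy (hFpow _ htF) hzx
      ((hzu.mul_right hzx).mul_right hzu.inv_right) (hN' _ hzN) (hFpow _ hzF)
    rw [← map_one φ] at this
    exact commutatorElement_eq_one_iff_commute.1 (hφ this)
  -- For `u` central in `F`, so is `[x,u]`, and the double commutator is trivial.
  have hZ : ∀ u ∈ F, (∀ v ∈ F, Commute u v) → Commute x u := by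
    intro u hu hcen
    have hconj : ∀ v ∈ F, Commute (x * u * x⁻¹) v := fun v hv => by
      have h1 := hcen _ (hF.conj_mem v hv x⁻¹)
      have h2 : Commute (x * u * x⁻¹) (x * (x⁻¹ * v * x⁻¹⁻¹) * x⁻¹) := by
        rw [Commute, SemiconjBy] at h1 ⊢
        simp only [inv_inv] at h1 ⊢
        calc x * u * x⁻¹ * (x * (x⁻¹ * v * x) * x⁻¹) = x * (u * (x⁻¹ * v * x)) * x⁻¹ := by group
          _ = _ := by rw [h1]; group
      have h3 : x * (x⁻¹ * v * x⁻¹⁻¹) * x⁻¹ = v := by group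
      rwa [h3] at h2
    have ht : ∀ v ∈ F, Commute ⁅x, u⁆ v := fun v hv => by
      rw [commutatorElement_def]
      exact (hconj v hv).mul_left (hcen v hv).inv_left
    have htF : ⁅x, u⁆ ∈ F := by
      rw [commutatorElement_def]
      exact F.mul_mem (hF.conj_mem u hu x) (F.inv_mem hu)
    have h1 : ⁅⁅x, u⁆, x * ⁅x, u⁆ * x⁻¹⁆ = 1 :=
      commutatorElement_eq_one_iff_commute.2 (ht _ (hF.conj_mem _ htF x))
    exact core u hu (h1 ▸ Commute.one_left _) (h1 ▸ Commute.one_left _)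
  -- For general `u` the double commutator is central in `F`, so it commutes with `x` by `hZ`.
  have hcent : ∀ u ∈ F, Commute x u := by
    intro u hu
    have htF : ⁅x, u⁆ ∈ F := by
      rw [commutatorElement_def]
      exact F.mul_mem (hF.conj_mem u hu x) (F.inv_mem hu)
    have hz := hcl _ htF _ (hF.conj_mem _ htF x)
    have hzF : ⁅⁅x, u⁆, x * ⁅x, u⁆ * x⁻¹⁆ ∈ F := Subgroup.commutator_le_left F F
      (Subgroup.commutator_mem_commutator htF (hF.conj_mem _ htF x))
    exact core u hu (hZ _ hzF hz).symm (hz u hu)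
  have hxF : x ∈ F := hC (Subgroup.mem_centralizer_iff.2 fun u hu => (hcent u hu).eq.symm)
  apply hφ
  rw [map_one, ← sub_eq_zero]
  refine eq_zero_of_isNilpotent_of_one_add_pow_eq_one
    (natCast_mul_cancel_of_coprime hE (hpF.pow_right k)) ⟨2, hx⟩ ?_
  rw [add_sub_cancel, ← map_pow, hFpow x hxF, map_one]

/-! ### Normality of the Sylow subgroup -/

/-- The largest normal `p`-subgroup. -/
theorem exists_largest_normal_isPGroup (G : Type*) [Group G] [Finite G] (p : ℕ) [Fact p.Prime] :
    ∃ R : Subgroup G, R.Normal ∧ IsPGroup p R ∧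
      ∀ D : Subgroup G, D.Normal → IsPGroup p D → D ≤ R :=
  ⟨sSup {D | D.Normal ∧ IsPGroup p D}, Subgroup.sSup_normal _ fun _ h => h.1,
    Sylow.sSup_of_normal _ (fun _ h => h.2) fun _ h => h.1, fun _ h1 h2 => le_sSup ⟨h1, h2⟩⟩

theorem isPGroup_of_forall_not_dvd {D : Type*} [Group D] [Finite D] {p : ℕ} [Fact p.Prime]
    (h : ∀ g : D, ¬ p ∣ orderOf g → g = 1) : IsPGroup p D := by
  intro g
  obtain ⟨k, m, hm, hgm⟩ := Nat.exists_eq_pow_mul_and_not_dvd (orderOf_pos g).ne' p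
    (Fact.out : p.Prime).ne_one
  refine ⟨k, h _ ?_⟩
  rwa [orderOf_pow_of_dvd (pow_pos (Fact.out : p.Prime).pos k).ne' ⟨m, hgm⟩, hgm,
    Nat.mul_div_cancel_left _ (pow_pos (Fact.out : p.Prime).pos k)]

theorem IsPGroup.eq_one_of_pow_eq_one {R : Type*} [Group R] {p : ℕ} [Fact p.Prime]
    (hR : IsPGroup p R) {m : ℕ} (hm : ¬ p ∣ m) {z : R} (hz : z ^ m = 1) : z = 1 := by
  by_contra h
  exact hm ((hR.dvd_orderOf h).trans (orderOf_dvd_of_pow_eq_one hz))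

/-- A `p'`-automorphism of a `p`-group of class at most two which acts trivially on the
abelianization is trivial. -/
theorem mulAut_eq_one_of_abelianization {R : Type*} [Group R] {p : ℕ} [Fact p.Prime]
    (hR : IsPGroup p R) (hcl : ∀ u v w : R, Commute ⁅u, v⁆ w) (σ : MulAut R)
    (hσ : ∀ r, σ r * r⁻¹ ∈ commutator R) {m : ℕ} (hm : ¬ p ∣ m) (hσm : σ ^ m = 1) : σ = 1 := by
  have hcen : ∀ z ∈ commutator R, ∀ w, Commute z w := by
    intro z hz w
    have : commutator R ≤ Subgroup.center R := Subgroup.commutator_le.2 fun a _ b _ =>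
      Subgroup.mem_center_iff.2 fun g => (hcl a b g).eq.symm
    exact (Subgroup.mem_center_iff.1 (this hz) w).symm
  have hfix : ∀ z ∈ commutator R, σ z = z := by
    intro z hz
    have hle : commutator R ≤ σ.toMonoidHom.eqLocus (MonoidHom.id R) := by
      refine Subgroup.commutator_le.2 fun a _ b _ => ?_
      change σ ⁅a, b⁆ = ⁅a, b⁆
      have ha : σ a = σ a * a⁻¹ * a := by group
      have hb : σ b = σ b * b⁻¹ * b := by group
      have key : ∀ z ∈ commutator R, ∀ z' ∈ commutator R, ⁅z * a, z' * b⁆ = ⁅a, b⁆ := by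
        intro z hz z' hz'
        calc ⁅z * a, z' * b⁆ = z * (a * z') * b * (a⁻¹ * z⁻¹) * (b⁻¹ * z'⁻¹) := by
              simp only [commutatorElement_def]; group
          _ = z * (z' * (a * b * a⁻¹)) * (z⁻¹ * b⁻¹) * z'⁻¹ := by
              rw [← (hcen z' hz' a).eq, ← ((hcen z hz a).inv_inv).eq]
              rw [((hcen z hz b).inv_inv).eq, ((hcen z hz a).inv_inv).eq]
              rw [← ((hcen z hz b).inv_inv).eq]
              simp only [mul_assoc]
          _ = z' * (a * b * a⁻¹) * (z * z⁻¹) * b⁻¹ * z'⁻¹ := by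
              rw [(hcen z hz _).eq]
              simp only [mul_assoc]
          _ = z' * (a * b * a⁻¹ * b⁻¹) * z'⁻¹ := by group
          _ = _ := by
              rw [(hcen z' hz' _).eq, mul_inv_cancel_right, commutatorElement_def]
      rw [map_commutatorElement, ha, hb]
      exact key _ (hσ a) _ (hσ b)
    exact hle hz
  ext r
  -- Since `σ` fixes `σ r * r⁻¹`, this displacement accumulates; at `i = m` it has `m`-th power one.
  have hpow : ∀ i : ℕ, (σ ^ i) r = (σ r * r⁻¹) ^ i * r := fun i => by
    induction i with
    | zero => simp
    | succ i ih =>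
      rw [pow_succ', MulAut.mul_apply, ih, map_mul, map_pow, hfix _ (hσ r), pow_succ, mul_assoc,
        inv_mul_cancel_right]
  have h1 := hpow m
  rw [hσm, MulAut.one_apply, right_eq_mul] at h1
  have := hR.eq_one_of_pow_eq_one hm h1
  rw [mul_inv_eq_one] at this
  exact this

theorem AddMonoid.End.ext_abelianization {R : Type*} [Group R]
    {f g : AddMonoid.End (Additive (Abelianization R))}
    (h : ∀ r : R, f (Additive.ofMul (Abelianization.of r)) =
      g (Additive.ofMul (Abelianization.of r))) : f = g := by
  refine DFunLike.ext f g fun v => ?_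
  obtain ⟨r, rfl⟩ : ∃ r : R, Additive.ofMul (Abelianization.of r) = v :=
    QuotientGroup.mk_surjective (s := commutator R) v
  exact h r

/-- The action of a group by conjugation on the abelianization of a normal subgroup. -/
def conjAbelianization {G : Type*} [Group G] (R : Subgroup G) [R.Normal] :
    G →* AddMonoid.End (Additive (Abelianization R)) where
  toFun g := MonoidHom.toAdditive (Abelianization.map (MulAut.conjNormal g : MulAut R).toMonoidHom)
  map_one' := by
    refine AddMonoid.End.ext_abelianization fun r => ?_
    change Additive.ofMul (Abelianization.of ((MulAut.conjNormal 1 : MulAut R) r)) = _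
    rw [map_one]
    rfl
  map_mul' g h := by
    refine AddMonoid.End.ext_abelianization fun r => ?_
    change Additive.ofMul (Abelianization.of ((MulAut.conjNormal (g * h) : MulAut R) r)) = _
    rw [map_mul]
    rfl

theorem conjAbelianization_apply {G : Type*} [Group G] (R : Subgroup G) [R.Normal] (g : G) (r : R) :
    conjAbelianization R g (Additive.ofMul (Abelianization.of r)) =
      Additive.ofMul (Abelianization.of (MulAut.conjNormal g r)) := rfl

/-- A finite soluble group without non-trivial normal `p'`-subgroups, `p` odd, whose Sylow
`p`-subgroup has class at most two and is contained in a normal subgroup of odd order has a normal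
Sylow `p`-subgroup. -/
theorem normal_sylow_of_class_two {G : Type*} [Group G] [Finite G] (hG : Group.IsSolvable G) {p : ℕ}
    [Fact p.Prime] (hp : Odd p)
    (hO : ∀ K : Subgroup G, K.Normal → ¬ p ∣ Nat.card K → K = ⊥)
    (N : Subgroup G) [N.Normal] (hN : Odd (Nat.card N)) (P : Sylow p G) (hPN : (P : Subgroup G) ≤ N)
    (hcl : ∀ a ∈ P, ∀ b ∈ P, ∀ c ∈ P, Commute ⁅a, b⁆ c) : (P : Subgroup G).Normal := by
  have hpp : p.Prime := Fact.out
  obtain ⟨R, hRn, hRp, hR⟩ := exists_largest_normal_isPGroup G p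
  obtain ⟨F, hF, hFcl, hFC⟩ := exists_normal_class_two_centralizer_le hG
  have hFp : IsPGroup p F := by
    refine isPGroup_of_forall_not_dvd fun g hg => ?_
    by_contra h1
    obtain ⟨q, hq, hqg⟩ := Nat.exists_prime_and_dvd (n := orderOf g)
      (fun h => h1 (orderOf_eq_one_iff.1 h))
    have : Fact q.Prime := ⟨hq⟩
    refine not_dvd_card_of_isNilpotent F (isNilpotent_of_class_two hFcl) (q := q)
      (fun D hD _ hDq => hO D hD fun hpD => ?_) (hqg.trans (orderOf_dvd_natCard g))
    obtain ⟨n, hn⟩ := IsPGroup.iff_card.1 hDq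
    rw [hn] at hpD
    exact hg ((Nat.prime_dvd_prime_iff_eq hpp hq).1 (hpp.dvd_of_dvd_pow hpD) ▸ hqg)
  have hRC : Subgroup.centralizer (R : Set G) ≤ R :=
    (Subgroup.centralizer_le (hR F hF hFp)).trans (hFC.trans (hR F hF hFp))
  have hRP : R ≤ P := hRp.le_sylow_of_normal P
  have hRcl : ∀ u v w : R, Commute ⁅u, v⁆ w := fun u v w =>
    Subtype.ext (hcl u (hRP u.2) v (hRP v.2) w (hRP w.2)).eq
  -- A `p'`-element of the kernel centralizes `R`, hence lies in the `p`-group `R` and is trivial;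
  -- so the kernel is a normal `p`-subgroup.
  have hker : (conjAbelianization R).ker ≤ R := by
    refine hR _ inferInstance (isPGroup_of_forall_not_dvd fun g hg => ?_)
    have hσ : ∀ r : R, (MulAut.conjNormal (g : G) : MulAut R) r * r⁻¹ ∈ commutator R := fun r => by
      have h1 := DFunLike.congr_fun g.2 (Additive.ofMul (Abelianization.of r))
      rw [conjAbelianization_apply] at h1
      have h2 : Abelianization.of ((MulAut.conjNormal (g : G) : MulAut R) r) =
        Abelianization.of r := h1
      rw [← Abelianization.ker_of, MonoidHom.mem_ker, map_mul, map_inv, h2, mul_inv_cancel]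
    have h1 := mulAut_eq_one_of_abelianization hRp hRcl _ hσ hg
      (by rw [← map_pow, ← Subgroup.coe_pow, pow_orderOf_eq_one, Subgroup.coe_one, map_one])
    have h2 : (g : G) ∈ R := hRC (Subgroup.mem_centralizer_iff.2 fun r hr => by
      have := congrArg Subtype.val (DFunLike.congr_fun h1 ⟨r, hr⟩)
      rw [MulAut.conjNormal_apply, MulAut.one_apply, mul_inv_eq_iff_eq_mul] at this
      exact this.symm)
    have h3 : (⟨g, h2⟩ : R) = 1 := hRp.eq_one_of_pow_eq_one hg (Subtype.ext (by
      have h3 := congrArg Subtype.val (pow_orderOf_eq_one g)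
      rwa [Subgroup.coe_pow] at h3 ⊢))
    exact Subtype.ext (congrArg (Subtype.val : R → G) h3)
  have hle : R ≤ (conjAbelianization R).ker := fun x hx => by
    refine AddMonoid.End.ext_abelianization fun r => ?_
    rw [conjAbelianization_apply]
    have : MulAut.conjNormal x r = (⟨x, hx⟩ : R) * r * (⟨x, hx⟩ : R)⁻¹ :=
      Subtype.ext (by simp)
    rw [this, map_mul Abelianization.of, map_mul Abelianization.of, map_inv,
      mul_right_comm, mul_inv_cancel, one_mul]
    rfl
  let φ := QuotientGroup.lift R (conjAbelianization R) hle
  have hφ : Function.Injective φ := by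
    refine (injective_iff_map_eq_one φ).2 fun a ha => ?_
    obtain ⟨g, rfl⟩ := QuotientGroup.mk_surjective a
    exact (QuotientGroup.eq_one_iff g).2 (hker ha)
  obtain ⟨k, hk⟩ := IsPGroup.iff_card.1 hRp
  have hE : ((p ^ k : ℕ) : AddMonoid.End (Additive (Abelianization R))) = 0 := by
    refine AddMonoid.End.ext_abelianization fun r => ?_
    rw [AddMonoid.End.natCast_apply, ← ofMul_pow, ← map_pow, ← hk, pow_card_eq_one', map_one]
    rfl
  have hO' : ∀ D : Subgroup (G ⧸ R), D.Normal → IsPGroup p D → D = ⊥ := fun D hD hDp => by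
    have h1 : D.comap (QuotientGroup.mk' R) ≤ R := hR _ inferInstance
      (hDp.comap_of_ker_isPGroup _ (by rwa [QuotientGroup.ker_mk']))
    refine (Subgroup.eq_bot_iff_forall _).2 fun d hd => ?_
    obtain ⟨g, rfl⟩ := QuotientGroup.mk_surjective d
    exact (QuotientGroup.eq_one_iff g).2 (h1 hd)
  have hNn : (N.map (QuotientGroup.mk' R)).Normal :=
    Subgroup.Normal.map inferInstance _ (QuotientGroup.mk'_surjective R)
  have hPR : (P : Subgroup G) ≤ R := fun x hx => by
    refine (QuotientGroup.eq_one_iff x).1 ?_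
    refine eq_one_of_quadratic (M := G ⧸ R) inferInstance φ hφ hp hE hO'
      (N.map (QuotientGroup.mk' R)) (hN.of_dvd_nat (Subgroup.card_map_dvd _ _))
      (Subgroup.mem_map_of_mem _ (hPN hx)) ?_
    refine AddMonoid.End.ext_abelianization fun r => ?_
    have hxr : ∀ s : R, conjAbelianization R x (Additive.ofMul (Abelianization.of s)) -
        Additive.ofMul (Abelianization.of s) =
        Additive.ofMul (Abelianization.of (MulAut.conjNormal x s * s⁻¹)) := fun s => by
      rw [conjAbelianization_apply, map_mul Abelianization.of, map_inv, ofMul_mul, ofMul_inv,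
        sub_eq_add_neg]
    -- This is `[x,[x,r]] = 1`, where the class of `P` enters; it gives `(x - 1)² = 0` on the
    -- abelianization.
    have hfix : MulAut.conjNormal x (MulAut.conjNormal x r * r⁻¹) = MulAut.conjNormal x r * r⁻¹ :=
      Subtype.ext <| by
        have := (hcl x hx r (hRP r.2) x hx).eq
        rw [commutatorElement_def] at this
        rw [MulAut.conjNormal_apply, Subgroup.coe_mul, MulAut.conjNormal_apply, Subgroup.coe_inv,
          ← this, mul_inv_cancel_right]
    have h1 : (conjAbelianization R x - 1) ((conjAbelianization R x - 1)
        (Additive.ofMul (Abelianization.of r))) = 0 := by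
      change conjAbelianization R x (conjAbelianization R x (Additive.ofMul (Abelianization.of r)) -
        Additive.ofMul (Abelianization.of r)) -
        (conjAbelianization R x (Additive.ofMul (Abelianization.of r)) -
        Additive.ofMul (Abelianization.of r)) = 0
      rw [hxr, conjAbelianization_apply, hfix, sub_self]
    rw [sq]
    exact h1
  exact le_antisymm hPR hRP ▸ hRn

/-! ### The odd primes and the conclusion -/

/-- A finite soluble `2`-nilpotent group with Sylow `p`-subgroups of class at most two, `p` odd,
has a quotient by a `p'`-subgroup in which the Sylow `p`-subgroup is normal; this yields a
transitive affine action. -/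
theorem hasTransitiveAffineAction_of_odd_prime {G : Type u} [Group G] [Finite G]
    (hG : Group.IsSolvable G) {p : ℕ} [Fact p.Prime] (hp : Odd p) (N : Subgroup G) [N.Normal]
    (hN : Odd (Nat.card N)) (P : Sylow p G) (hPN : (P : Subgroup G) ≤ N)
    (hcl : ∀ a ∈ P, ∀ b ∈ P, ∀ c ∈ P, Commute ⁅a, b⁆ c) :
    HasTransitiveAffineAction G (p ^ (Nat.card G).factorization p) := by
  have hpp : p.Prime := Fact.out
  let S : Set (Subgroup G) := {K | K.Normal ∧ ¬ p ∣ Nat.card K}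
  have hS : S.Nonempty := ⟨⊥, inferInstance, by simpa using hpp.ne_one⟩
  obtain ⟨K, ⟨hK, hKp⟩, hmax⟩ := S.toFinite.exists_maximal hS
  let f := QuotientGroup.mk' K
  have hf : Function.Surjective f := QuotientGroup.mk'_surjective K
  have hO : ∀ D : Subgroup (G ⧸ K), D.Normal → ¬ p ∣ Nat.card D → D = ⊥ := fun D hD hDp => by
    have hle : K ≤ D.comap f := fun x hx => by
      rw [Subgroup.mem_comap, show f x = 1 from (QuotientGroup.eq_one_iff x).2 hx]
      exact D.one_mem
    have hcard : Nat.card (D.comap f) = Nat.card D * Nat.card K := by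
      have h1 := Subgroup.card_mul_index (D.comap f)
      rw [Subgroup.index_comap_of_surjective _ hf, K.card_eq_card_quotient_mul_card_subgroup,
        ← D.card_mul_index, mul_right_comm] at h1
      exact Nat.eq_of_mul_eq_mul_right (Nat.pos_of_ne_zero D.index_ne_zero_of_finite) h1
    have hmem : D.comap f ∈ S := ⟨inferInstance, by
      rw [hcard, hpp.dvd_mul]
      tauto⟩
    refine (Subgroup.eq_bot_iff_forall _).2 fun d hd => ?_
    obtain ⟨g, rfl⟩ := hf d
    exact (QuotientGroup.eq_one_iff g).2 (hmax hmem hle hd)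
  have hNn : (N.map f).Normal := Subgroup.Normal.map inferInstance _ hf
  let P' : Sylow p (G ⧸ K) := P.mapSurjective hf
  have hP' : (P' : Subgroup (G ⧸ K)) = (P : Subgroup G).map f := rfl
  have hcl' : ∀ a ∈ P', ∀ b ∈ P', ∀ c ∈ P', Commute ⁅a, b⁆ c := by
    rintro _ ⟨a, ha, rfl⟩ _ ⟨b, hb, rfl⟩ _ ⟨c, hc, rfl⟩
    rw [← map_commutatorElement]
    exact (hcl a ha b hb c hc).map f
  have hnorm := normal_sylow_of_class_two (G := G ⧸ K) inferInstance hp hO (N.map f)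
    (hN.of_dvd_nat (Subgroup.card_map_dvd _ _)) P' (Subgroup.map_mono hPN) hcl'
  -- Schur–Zassenhaus splits the quotient as `P' ⋊ H`.
  obtain ⟨H, hH⟩ := Subgroup.exists_right_complement'_of_coprime P'.card_coprime_index
  have hcardP : Nat.card P' = p ^ (Nat.card G).factorization p := by
    rw [P'.card_eq_multiplicity, K.card_eq_card_quotient_mul_card_subgroup,
      Nat.factorization_mul Nat.card_pos.ne' Nat.card_pos.ne', Finsupp.add_apply,
      Nat.factorization_eq_zero_of_not_dvd hKp, add_zero]
  rw [← hcardP]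
  have h1 := hasTransitiveAffineAction_semidirectProduct_of_odd
    ((MulAut.conjNormal (H := (P' : Subgroup (G ⧸ K)))).comp H.subtype)
    (fun u v w => Subtype.ext (hcl' u u.2 v v.2 w w.2).eq) (by rw [hcardP]; exact hp.pow)
  have h2 := h1.of_surjective (SemidirectProduct.mulEquivSubgroup hH).symm.toMonoidHom
    (SemidirectProduct.mulEquivSubgroup hH).symm.surjective
  exact h2.of_surjective f hf

theorem mainTheorem6 (G : Type u) [Group G] [Finite G] (hsol : Group.IsSolvable G)
    (hclass : ∀ (p : ℕ) [Fact p.Prime] (P : Sylow p G),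
      Group.IsNilpotent P ∧ Group.nilpotencyClass P ≤ 2)
    (h2 : IsPNilpotentGroup 2 G) :
    IsIYBGroup G := by
  obtain ⟨N, hN, hcomp⟩ := h2
  obtain ⟨Q⟩ : Nonempty (Sylow 2 G) := inferInstance
  have hcl : ∀ (p : ℕ) [Fact p.Prime] (P : Sylow p G), ∀ a ∈ P, ∀ b ∈ P, ∀ c ∈ P,
      Commute ⁅a, b⁆ c := fun p _ P =>
    class_two_of_nilpotencyClass_le (hclass p P).1 (hclass p P).2
  have hNQ := hcomp Q
  have hNodd : Odd (Nat.card N) := by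
    rw [← Nat.not_even_iff_odd, even_iff_two_dvd, ← hNQ.index_eq_card]
    exact Q.not_dvd_index
  let e : G ⧸ N ≃* Q := hNQ.symm.QuotientMulEquiv
  refine IsIYBGroup.of_forall_primeFactors fun p hp => ?_
  have : Fact p.Prime := ⟨hp⟩
  rcases hp.eq_two_or_odd' with rfl | hodd
  · have h1 := hasTransitiveAffineAction_of_class_two (P := Q) fun u v w =>
      Subtype.ext (hcl 2 Q u u.2 v v.2 w w.2).eq
    rw [Q.card_eq_multiplicity] at h1
    exact h1.of_surjective (e.toMonoidHom.comp (QuotientGroup.mk' N))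
      (e.surjective.comp (QuotientGroup.mk'_surjective N))
  · obtain ⟨P⟩ : Nonempty (Sylow p G) := inferInstance
    refine hasTransitiveAffineAction_of_odd_prime hsol hodd N hNodd P (fun x hx => ?_) (hcl p P)
    -- An element of odd order dies in the 2-group `G/N`, so `P ≤ N`.
    obtain ⟨k, hk⟩ := P.2 ⟨x, hx⟩
    have hx1 : x ^ p ^ k = 1 := congrArg Subtype.val hk
    refine (QuotientGroup.eq_one_iff x).1 ((Q.2.of_equiv e.symm).eq_one_of_pow_eq_one
      (m := p ^ k) ?_ ?_)
    · rw [← even_iff_two_dvd, Nat.not_even_iff_odd]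
      exact hodd.pow
    · rw [← QuotientGroup.mk_pow, hx1, QuotientGroup.mk_one]
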